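/- For a complex number $m$ and an integer $N\ge 0$ let $H_{N,m}=\sum_{r=1}^{N} r^{-m}$ denote the generalized harmonic number of order $m$ (the empty sum being $0$), and let $\zeta$ be the Riemann zeta function. (i) For every complex number $n$ and every integer $N\ge 0$, $$3\sum_{r=1}^{N}\frac{H_{r,n}^2}{r^n}-3\sum_{r=1}^{N}\frac{H_{r,n}}{r^{2n}}=H_{N,n}^3-H_{N,3n}.$$ (ii) The following series converge absolutely, with the indicated values: $$\sum_{r=1}^{\infty}\frac{H_{r,2}}{r^4}=\zeta(3)^2-\frac{\pi^6}{2835},$$ $$\sum_{r=1}^{\infty}\frac{H_{r,2}^2}{r^2}=\frac{19}{22680}\pi^6+\zeta(3)^2,\qquad \sum_{r=1}^{\infty}\frac{H_{r,2}^2}{(r+1)^2}=\frac{59}{22680}\pi^6-\zeta(3)^2.$$ -/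

import Mathlib

/-- The generalized harmonic number `H_{N,m} = ∑_{r=1}^N 1 / r^m` of complex order `m`. -/
noncomputable def genHarmonic (N : ℕ) (m : ℂ) : ℂ :=
  ∑ r ∈ Finset.Icc 1 N, 1 / (r : ℂ) ^ m

/-! Part (i) is the increment of a cube: with `x = 1 / r^n` and `H = H_{r,n}`, one has `H^3 - (H -
x)^3 = 3 H^2 x - 3 H x^2 + x^3`. For (ii), write `L(i,j)` for the sum of `1 / (a^i (a+b)^j)` over
`a, b ≥ 1`. Splitting products of zeta values by order of indices, together with a partial-fraction
identity, gives `L(2,4) = ζ(3)^2 - (4/3) ζ(6)`; adding the diagonal `ζ(6)` gives the first series.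
Part (i) at `n = 2`, as `N → ∞`, converts it into the second. Expanding `(H_{r+1,2} - 1/(r+1)^2)^2`
gives the third from the first two. -/

/-- A finite telescoping identity for the cubes of generalized harmonic numbers. -/
theorem genHarmonic_cube_telescope (n : ℂ) (N : ℕ) :
    3 * ∑ r ∈ Finset.Icc 1 N, genHarmonic r n ^ 2 / (r : ℂ) ^ n
        - 3 * ∑ r ∈ Finset.Icc 1 N, genHarmonic r n / (r : ℂ) ^ (2 * n)
        = genHarmonic N n ^ 3 - genHarmonic N (3 * n) := by
  induction N with
  | zero => simp [genHarmonic]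
  | succ N ih =>
    have step (m : ℂ) :
        genHarmonic (N + 1) m = genHarmonic N m + 1 / ((N + 1 : ℕ) : ℂ) ^ m :=
      Finset.sum_Icc_succ_top (by omega) _
    have hc : ((N + 1 : ℕ) : ℂ) ^ n ≠ 0 :=
      Complex.cpow_ne_zero_iff.mpr (.inl (Nat.cast_ne_zero.mpr N.succ_ne_zero))
    have h2 : ((N + 1 : ℕ) : ℂ) ^ (2 * n) = (((N + 1 : ℕ) : ℂ) ^ n) ^ 2 := by
      rw [← Complex.cpow_nat_mul]; norm_num
    have h3 : ((N + 1 : ℕ) : ℂ) ^ (3 * n) = (((N + 1 : ℕ) : ℂ) ^ n) ^ 3 := by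
      rw [← Complex.cpow_nat_mul]; norm_num
    rw [Finset.sum_Icc_succ_top (by omega), Finset.sum_Icc_succ_top (by omega), mul_add, mul_add,
      add_sub_add_comm, ih, step, step, h2, h3]
    field_simp
    ring

/-! ### Double sums over pairs of positive integers -/

section DoubleSums

theorem HasSum.of_pointwise_eq {ι : Type*} {f g : ι → ℂ} {a : ℂ} (h : HasSum f a)
    (e : ∀ i, g i = f i) : HasSum g a := by
  rwa [funext e]

variable {f g : ℕ+ → ℂ}

theorem injective_prodMk_self_add :
    Function.Injective (fun p : ℕ+ × ℕ+ => (p.1, p.1 + p.2)) := by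
  rintro ⟨a, b⟩ ⟨c, d⟩ h
  simp only [Prod.mk.injEq] at h
  obtain ⟨rfl, h⟩ := h
  simpa using h

theorem range_prodMk_self_add :
    Set.range (fun p : ℕ+ × ℕ+ => (p.1, p.1 + p.2)) = {q | q.1 < q.2} := by
  ext ⟨a, b⟩
  simp only [Set.mem_range, Prod.mk.injEq, Prod.exists, Set.mem_ofPred_eq]
  constructor
  · rintro ⟨c, d, rfl, rfl⟩
    exact PNat.lt_add_right c d
  · intro h
    exact ⟨a, b - a, rfl, PNat.add_sub_of_lt h⟩

theorem summable_mul_self_add (hf : Summable fun n => ‖f n‖) (hg : Summable fun n => ‖g n‖) :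
    Summable fun p : ℕ+ × ℕ+ => f p.1 * g (p.1 + p.2) := by
  have h : Summable fun q : ℕ+ × ℕ+ => f q.1 * g q.2 := summable_mul_of_summable_norm hf hg
  simpa only [Function.comp_def] using h.comp_injective injective_prodMk_self_add

theorem hasSum_indicator_lt (hf : Summable fun n => ‖f n‖) (hg : Summable fun n => ‖g n‖) :
    HasSum ({q : ℕ+ × ℕ+ | q.1 < q.2}.indicator fun q => f q.1 * g q.2)
      (∑' p : ℕ+ × ℕ+, f p.1 * g (p.1 + p.2)) := by
  rw [← range_prodMk_self_add, ← hasSum_subtype_iff_indicator]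
  exact (injective_prodMk_self_add.hasSum_range_iff
    (f := fun q : ℕ+ × ℕ+ => f q.1 * g q.2)).mpr (summable_mul_self_add hf hg).hasSum

theorem hasSum_indicator_diag (hf : Summable fun n => ‖f n‖) (hg : Summable fun n => ‖g n‖) :
    HasSum ({q : ℕ+ × ℕ+ | q.1 = q.2}.indicator fun q => f q.1 * g q.2) (∑' n, f n * g n) := by
  have hinj : Function.Injective (fun n : ℕ+ => (n, n)) := fun a b h => congrArg Prod.fst h
  have hrange : Set.range (fun n : ℕ+ => (n, n)) = {q | q.1 = q.2} := by
    ext ⟨a, b⟩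
    simp
  rw [← hrange, ← hasSum_subtype_iff_indicator]
  have h : Summable fun q : ℕ+ × ℕ+ => f q.1 * g q.2 := summable_mul_of_summable_norm hf hg
  exact (hinj.hasSum_range_iff (f := fun q : ℕ+ × ℕ+ => f q.1 * g q.2)).mpr
    (h.comp_injective hinj).hasSum

/-- The quasi-shuffle product of two absolutely convergent series. -/
theorem tsum_mul_tsum_eq_strict_add_diag (hf : Summable fun n => ‖f n‖)
    (hg : Summable fun n => ‖g n‖) :
    (∑' n, f n) * ∑' n, g n =
      (∑' p : ℕ+ × ℕ+, f p.1 * g (p.1 + p.2)) + (∑' p : ℕ+ × ℕ+, g p.1 * f (p.1 + p.2))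
        + ∑' n, f n * g n := by
  rw [tsum_mul_tsum_of_summable_norm hf hg]
  refine HasSum.tsum_eq ?_
  have h := ((hasSum_indicator_lt hf hg).add
    ((Equiv.prodComm ℕ+ ℕ+).hasSum_iff.mpr (hasSum_indicator_lt hg hf))).add
    (hasSum_indicator_diag hf hg)
  refine h.of_pointwise_eq ?_
  rintro ⟨a, b⟩
  rcases lt_trichotomy a b with hab | rfl | hab
  · simp [Set.indicator, hab, hab.not_gt, hab.ne]
  · simp [Set.indicator]
  · simp [Set.indicator, hab, hab.not_gt, hab.ne', mul_comm]

/-- The pairs `m ≤ r` are the strict pairs and the diagonal; summing first over `m` at fixed `r`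
produces the partial sums. -/
theorem hasSum_partialSum_mul (hf : Summable fun n => ‖f n‖) (hg : Summable fun n => ‖g n‖) :
    HasSum (fun r : ℕ+ => (∑ m ∈ Finset.Icc 1 r, f m) * g r)
      ((∑' p : ℕ+ × ℕ+, f p.1 * g (p.1 + p.2)) + ∑' n, f n * g n) := by
  have h := (Equiv.prodComm ℕ+ ℕ+).hasSum_iff.mpr
    ((hasSum_indicator_lt hf hg).add (hasSum_indicator_diag hf hg))
  refine h.prod_fiberwise fun r => ?_
  rw [Finset.sum_mul]
  have hsupp : ∀ m ∉ Finset.Icc 1 r, (if m ≤ r then f m * g r else 0) = 0 := by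
    intro m hm
    exact if_neg fun h => hm (Finset.mem_Icc.mpr ⟨one_le, h⟩)
  have h := hasSum_sum_of_ne_finset_zero (L := SummationFilter.unconditional ℕ+) hsupp
  rw [Finset.sum_congr rfl fun m hm => if_pos (Finset.mem_Icc.mp hm).2] at h
  refine h.of_pointwise_eq fun m => ?_
  rcases lt_trichotomy m r with h | rfl | h
  · simp [Set.indicator, h, h.le, h.ne]
  · simp [Set.indicator]
  · simp [Set.indicator, h.not_gt, h.not_ge, h.ne']

end DoubleSums

theorem genHarmonic_pnat (r : ℕ+) (k : ℕ) :
    genHarmonic r k = ∑ m ∈ Finset.Icc 1 r, 1 / (m : ℂ) ^ k := by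
  rw [genHarmonic]
  refine (Finset.sum_bij (fun (m : ℕ+) _ => (m : ℕ)) ?_ ?_ ?_ ?_).symm
  · intro m hm
    exact Finset.mem_Icc.mpr ⟨m.pos, (Finset.mem_Icc.mp hm).2⟩
  · intro a _ b _ h
    exact PNat.coe_injective h
  · intro m hm
    obtain ⟨h1, h2⟩ := Finset.mem_Icc.mp hm
    exact ⟨⟨m, h1⟩, Finset.mem_Icc.mpr ⟨one_le, h2⟩, rfl⟩
  · intro m _
    rw [Complex.cpow_natCast]

theorem summable_norm_one_div_pnat_pow {k : ℕ} (hk : 1 < k) :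
    Summable fun n : ℕ+ => ‖1 / (n : ℂ) ^ k‖ := by
  have h := ((Real.summable_one_div_nat_pow (p := k)).mpr hk).comp_injective PNat.coe_injective
  simpa [Function.comp_def] using h

theorem hasSum_one_div_pnat_pow {k : ℕ} (hk : 1 < k) :
    HasSum (fun n : ℕ+ => 1 / (n : ℂ) ^ k) (riemannZeta k) := by
  have h0 : (1 : ℂ) / ((0 : ℕ) : ℂ) ^ k = 0 := by simp; omega
  have h := (summable_norm_one_div_pnat_pow hk).of_norm.hasSum
  have e := (hasSum_pnat_iff (f := fun n : ℕ => 1 / (n : ℂ) ^ k)).mp h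
  rw [h0, add_zero] at e
  rwa [zeta_nat_eq_tsum_of_gt_one hk, e.tsum_eq]

/-! ### Evaluations in weight six -/

theorem bernoulli_six : bernoulli 6 = 1 / 42 := by
  have h5 : bernoulli' 5 = 0 := bernoulli'_eq_zero_of_odd (by decide) (by norm_num)
  have h2 : Nat.choose 6 2 = 15 := by decide
  have h4 : Nat.choose 6 4 = 15 := by decide
  rw [bernoulli_eq_bernoulli'_of_ne_one (by norm_num), bernoulli'_def]
  norm_num [Finset.sum_range_succ, h5, h2, h4]

theorem riemannZeta_six : riemannZeta 6 = (Real.pi : ℂ) ^ 6 / 945 := by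
  have h := riemannZeta_two_mul_nat (k := 3) (by norm_num)
  norm_num [bernoulli_six, Nat.factorial] at h
  rw [h]
  ring

/-- Partial fractions yield `3 ζ(2) ζ(4) - 2 ζ(3)^2 = 3 L(4,2) + 2 L(3,3)`. The quasi-shuffle
products `ζ(2) ζ(4) = L(2,4) + L(4,2) + ζ(6)` and `ζ(3)^2 = 2 L(3,3) + ζ(6)` then eliminate
`L(4,2)`, `L(3,3)` and `ζ(2) ζ(4)`. -/
theorem tsum_strict_two_four :
    ∑' p : ℕ+ × ℕ+, 1 / ((p.1 : ℕ) : ℂ) ^ 2 * (1 / ((p.1 + p.2 : ℕ+) : ℂ) ^ 4)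
      = riemannZeta 3 ^ 2 - 4 / 3 * riemannZeta 6 := by
  have s2 := summable_norm_one_div_pnat_pow (k := 2) (by norm_num)
  have s3 := summable_norm_one_div_pnat_pow (k := 3) (by norm_num)
  have s4 := summable_norm_one_div_pnat_pow (k := 4) (by norm_num)
  have z3 := (hasSum_one_div_pnat_pow (k := 3) (by norm_num)).tsum_eq
  have z6 := (hasSum_one_div_pnat_pow (k := 6) (by norm_num)).tsum_eq
  have e24 := tsum_mul_tsum_eq_strict_add_diag s2 s4
  have e33 := tsum_mul_tsum_eq_strict_add_diag s3 s3
  have d24 (n : ℕ+) : 1 / (n : ℂ) ^ 2 * (1 / (n : ℂ) ^ 4) = 1 / (n : ℂ) ^ 6 := by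
    field_simp
  have d33 (n : ℕ+) : 1 / (n : ℂ) ^ 3 * (1 / (n : ℂ) ^ 3) = 1 / (n : ℂ) ^ 6 := by
    field_simp
  simp only [d24, d33] at e24 e33
  have H24 := (summable_mul_of_summable_norm s2 s4).hasSum
  have H33 := (summable_mul_of_summable_norm s3 s3).hasSum
  have L42 := (summable_mul_self_add s4 s2).hasSum
  have L33 := (summable_mul_self_add s3 s3).hasSum
  rw [← tsum_mul_tsum_of_summable_norm s2 s4] at H24
  rw [← tsum_mul_tsum_of_summable_norm s3 s3] at H33
  have sw {F : ℕ+ × ℕ+ → ℂ} {a : ℂ} (h : HasSum F a) : HasSum (F ∘ Prod.swap) a :=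
    (Equiv.prodComm ℕ+ ℕ+).hasSum_iff.mpr h
  -- The ratio 3 : 2 cancels both `L(1,5)` and `L(2,4)` in the partial-fraction expansions. The
  -- summand vanishes pointwise only after symmetrizing in the two indices, hence the swapped
  -- copies.
  have key := ((((H24.add (sw H24)).mul_left (3 / 2)).sub (H33.mul_left 2)).sub
    ((L42.add (sw L42)).mul_left (3 / 2))).sub (L33.add (sw L33))
  have zero := key.unique (hasSum_zero.of_pointwise_eq fun p => ?_)
  · rw [z3, z6] at e33
    rw [z6] at e24
    rw [z3] at zero
    push_cast at *
    linear_combination (1 / 3) * zero - e24 - (1 / 3) * e33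
  · have h1 : ((p.1 : ℕ) : ℂ) ≠ 0 := Nat.cast_ne_zero.mpr p.1.ne_zero
    have h2 : ((p.2 : ℕ) : ℂ) ≠ 0 := Nat.cast_ne_zero.mpr p.2.ne_zero
    have h3 : ((p.1 : ℕ) : ℂ) + ((p.2 : ℕ) : ℂ) ≠ 0 := by
      exact_mod_cast (p.1 + p.2).ne_zero
    have h4 : ((p.2 : ℕ) : ℂ) + ((p.1 : ℕ) : ℂ) ≠ 0 := by rwa [add_comm]
    simp only [Function.comp_apply, Prod.fst_swap, Prod.snd_swap, PNat.add_coe, Nat.cast_add]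
    rw [add_comm ((p.2 : ℕ) : ℂ)]
    field_simp
    ring

theorem hasSum_genHarmonic_two_div_pow_four :
    HasSum (fun r : ℕ+ => genHarmonic r 2 / (r : ℂ) ^ 4)
      (riemannZeta 3 ^ 2 - (Real.pi : ℂ) ^ 6 / 2835) := by
  have s2 := summable_norm_one_div_pnat_pow (k := 2) (by norm_num)
  have s4 := summable_norm_one_div_pnat_pow (k := 4) (by norm_num)
  have z6 := (hasSum_one_div_pnat_pow (k := 6) (by norm_num)).tsum_eq
  have d24 (n : ℕ+) : 1 / (n : ℂ) ^ 2 * (1 / (n : ℂ) ^ 4) = 1 / (n : ℂ) ^ 6 := by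
    field_simp
  have h := hasSum_partialSum_mul s2 s4
  simp only [d24, ← genHarmonic_pnat] at h
  rw [z6, tsum_strict_two_four] at h
  simp only [mul_one_div] at h
  rw [Nat.cast_ofNat, Nat.cast_ofNat, riemannZeta_six] at h
  convert! h using 1
  ring

theorem summable_genHarmonic_two_sq_div_sq :
    Summable fun r : ℕ+ => genHarmonic r 2 ^ 2 / (r : ℂ) ^ 2 := by
  have s2 := summable_norm_one_div_pnat_pow (k := 2) (by norm_num)
  set C := ∑' n : ℕ+, ‖1 / (n : ℂ) ^ 2‖
  refine Summable.of_norm_bounded (s2.mul_left (C ^ 2)) fun r => ?_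
  -- `H_{r,2}` is bounded by the full series, so `1 / r^2` dominates up to a constant.
  have hC : ‖genHarmonic r 2‖ ≤ C := by
    have h := genHarmonic_pnat r 2
    rw [Nat.cast_ofNat] at h
    rw [h]
    exact (norm_sum_le _ _).trans (s2.sum_le_tsum _ fun _ _ => norm_nonneg _)
  rw [← mul_one_div, norm_mul, norm_pow]
  gcongr

theorem sum_range_succ_eq_sum_Icc (f : ℕ → ℂ) (N : ℕ) :
    ∑ n ∈ Finset.range N, f (n + 1) = ∑ n ∈ Finset.Icc 1 N, f n := by
  induction N with
  | zero => simp
  | succ N ih => rw [Finset.sum_range_succ, ih, Finset.sum_Icc_succ_top (by omega)]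

theorem tendsto_genHarmonic {k : ℕ} (hk : 1 < k) :
    Filter.Tendsto (fun N => genHarmonic N k) Filter.atTop (nhds (riemannZeta k)) := by
  have h := ((hasSum_pnat_iff_hasSum_succ (f := fun n : ℕ => 1 / (n : ℂ) ^ k)).mp
    (hasSum_one_div_pnat_pow hk)).tendsto_sum_nat
  refine h.congr fun N => ?_
  simp only [genHarmonic, Complex.cpow_natCast]
  exact sum_range_succ_eq_sum_Icc (fun n : ℕ => 1 / (n : ℂ) ^ k) N

theorem hasSum_genHarmonic_two_sq_div_sq :
    HasSum (fun r : ℕ+ => genHarmonic r 2 ^ 2 / (r : ℂ) ^ 2)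
      (19 / 22680 * (Real.pi : ℂ) ^ 6 + riemannZeta 3 ^ 2) := by
  have partialSums {f : ℕ → ℂ} {a : ℂ} (h : HasSum (fun r : ℕ+ => f r) a) :
      Filter.Tendsto (fun N => ∑ r ∈ Finset.Icc 1 N, f r) Filter.atTop (nhds a) := by
    refine (hasSum_pnat_iff_hasSum_succ.mp h).tendsto_sum_nat.congr fun N => ?_
    exact sum_range_succ_eq_sum_Icc _ N
  have hs := summable_genHarmonic_two_sq_div_sq.hasSum
  have t1 := partialSums (f := fun r => genHarmonic r 2 / (r : ℂ) ^ 4)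
    hasSum_genHarmonic_two_div_pow_four
  have t2 := partialSums (f := fun r => genHarmonic r 2 ^ 2 / (r : ℂ) ^ 2) hs
  have u2 := tendsto_genHarmonic (k := 2) (by norm_num)
  have u6 := tendsto_genHarmonic (k := 6) (by norm_num)
  rw [Nat.cast_ofNat] at u2 u6
  -- Both sides of the finite identity converge; the limit reads `3 S - 3 T = ζ(2)^3 - ζ(6)`, with
  -- `S` the unknown sum and `T` the first series.
  have e := tendsto_nhds_unique (((t2.const_mul 3).sub (t1.const_mul 3)).congr fun N => ?_)
    ((u2.pow 3).sub u6)
  · rw [riemannZeta_two, riemannZeta_six] at e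
    convert! hs using 1
    linear_combination (-1 / 3) * e
  · have h := genHarmonic_cube_telescope 2 N
    norm_num at h
    exact_mod_cast h

theorem hasSum_genHarmonic_two_sq_div_succ_sq :
    HasSum (fun r : ℕ+ => genHarmonic r 2 ^ 2 / ((r : ℂ) + 1) ^ 2)
      (59 / 22680 * (Real.pi : ℂ) ^ 6 - riemannZeta 3 ^ 2) := by
  have h6 := hasSum_one_div_pnat_pow (k := 6) (by norm_num)
  rw [Nat.cast_ofNat, riemannZeta_six] at h6
  have h := (hasSum_genHarmonic_two_sq_div_sq.sub
    (hasSum_genHarmonic_two_div_pow_four.mul_left 2)).add h6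
  set F : ℕ → ℂ := fun r => genHarmonic r 2 ^ 2 / (r : ℂ) ^ 2
    - 2 * (genHarmonic r 2 / (r : ℂ) ^ 4) + 1 / (r : ℂ) ^ 6 with hF
  -- `F r = H_{r-1,2}^2 / r^2` for `r ≥ 1`, and `H_{0,2} = 0`, so shifting the index by one loses
  -- nothing.
  have hF1 : F 1 = 0 := by norm_num [hF, genHarmonic]
  have h1 := hasSum_pnat_iff_hasSum_succ (f := F).mp h
  rw [← hasSum_nat_add_iff' (f := fun n => F (n + 1)) 1, Finset.sum_range_one, zero_add, hF1,
    sub_zero] at h1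
  have h2 := hasSum_pnat_iff_hasSum_succ (f := fun n => F (n + 1)) |>.mpr h1
  have hval : 59 / 22680 * (Real.pi : ℂ) ^ 6 - riemannZeta 3 ^ 2 =
      19 / 22680 * (Real.pi : ℂ) ^ 6 + riemannZeta 3 ^ 2
        - 2 * (riemannZeta 3 ^ 2 - (Real.pi : ℂ) ^ 6 / 2835) + (Real.pi : ℂ) ^ 6 / 945 := by
    ring
  rw [hval]
  refine h2.of_pointwise_eq fun r => ?_
  have hr : ((r : ℕ) : ℂ) + 1 ≠ 0 := Nat.cast_add_one_ne_zero _
  have step : genHarmonic (r + 1) 2 = genHarmonic r 2 + 1 / ((r : ℂ) + 1) ^ 2 := by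
    rw [genHarmonic, Finset.sum_Icc_succ_top (by omega), ← genHarmonic, Complex.cpow_ofNat,
      Nat.cast_add_one]
  simp only [hF, step, Nat.cast_add_one]
  field_simp
  ring

theorem mainTheorem3 :
    (∀ (n : ℂ) (N : ℕ),
      3 * ∑ r ∈ Finset.Icc 1 N, genHarmonic r n ^ 2 / (r : ℂ) ^ n
        - 3 * ∑ r ∈ Finset.Icc 1 N, genHarmonic r n / (r : ℂ) ^ (2 * n)
        = genHarmonic N n ^ 3 - genHarmonic N (3 * n)) ∧
    HasSum (fun r : ℕ+ => genHarmonic (r : ℕ) 2 / ((r : ℕ) : ℂ) ^ 4)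
      (riemannZeta 3 ^ 2 - (Real.pi : ℂ) ^ 6 / 2835) ∧
    HasSum (fun r : ℕ+ => genHarmonic (r : ℕ) 2 ^ 2 / ((r : ℕ) : ℂ) ^ 2)
      (19 / 22680 * (Real.pi : ℂ) ^ 6 + riemannZeta 3 ^ 2) ∧
    HasSum (fun r : ℕ+ => genHarmonic (r : ℕ) 2 ^ 2 / (((r : ℕ) : ℂ) + 1) ^ 2)
      (59 / 22680 * (Real.pi : ℂ) ^ 6 - riemannZeta 3 ^ 2) :=
  ⟨genHarmonic_cube_telescope, hasSum_genHarmonic_two_div_pow_four,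
    hasSum_genHarmonic_two_sq_div_sq, hasSum_genHarmonic_two_sq_div_succ_sq⟩
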